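/- **(FLDR Partial Correctness.)** Let $n\ge 1$ and let $a_1,\dots,a_n$ be positive integers, $m=\sum_{i=1}^n a_i$, $k=\lceil\log_2 m\rceil$ and $a_{n+1}=2^k-m$. For an integer-valued array $h$ and $c\in\mathbb Z$ put $B_h(c)=2^c-\sum_{j=0}^{c}h[j]\,2^{c-j}$ (the sum is empty for $c<0$). An array $h$ and a matrix $H$, both initially $0$ everywhere, are filled by the following preprocessing: for $j=0,\dots,k$ do: set $d:=2B_h(j-1)-1$; then for $i=1,\dots,n+1$ do: let $w\in\{0,1\}$ be the binary digit of weight $2^{k-j}$ of $a_i$; set $h[j]:=h[j]+w$; if $w=1$, set $H[d,j]:=i$ and $d:=d-1$. With these fixed $h,H$, let $C_{\mathrm{FLDR}}$ be the probabilistic program over the integer variables $c,d,n$ $$\mathtt{while}\,(d<B_h(c))\,\{\;c:=c+1;\;\;\{d:=2d\}\,[1/2]\,\{d:=2d+1\};\;\;\mathtt{if}\,(H[d,c]=n+1)\,\{c:=0;\;d:=0\}\;\}.$$ Program states are maps $\sigma:\{c,d,n\}\to\mathbb Z$, and a sub-distribution is a function $\mu$ from states to $[0,1]$ of total mass at most $1$.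 For a predicate $B$, $[B]\cdot\mu$ is the function equal to $\mu$ where $B$ holds and $0$ elsewhere. A program $C$ transforms sub-distributions by its denotational semantics $[\![C]\!]$, defined by recursion on $C$: - $[\![\mathtt{skip}]\!](\mu)=\mu$, and $[\![C_1;C_2]\!](\mu)=[\![C_2]\!]([\![C_1]\!](\mu))$; - $[\![x:=E]\!](\mu)(\sigma)=\sum_{\sigma':\,\sigma'[x/E(\sigma')]=\sigma}\mu(\sigma')$; - $[\![\{C_1\}[p]\{C_2\}]\!](\mu)=[\![C_1]\!](p\mu)+[\![C_2]\!]((1-p)\mu)$; - $[\![\mathtt{if}\,(B)\,\{C_1\}\,\mathtt{else}\,\{C_2\}]\!](\mu)=[\![C_1]\!]([B]\cdot\mu)+[\![C_2]\!]([\neg B]\cdot\mu)$ (a missing else-branch is $\mathtt{skip}$); - $[\![\mathtt{while}\,(B)\,\{C\}]\!]$ is the least fixed point (pointwise order) of $f\mapsto\big(\eta\mapsto[\neg B]\cdot\eta+f([\![C]\!]([B]\cdot\eta))\big)$. The initial distributions are the Dirac distributions $\mu_0=\delta_{d\mapsto 0,\,c\mapsto 0,\,n\mapsto N}$ with $N$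 a positive integer. **Lemma.** For every initial distribution $\mu_0$ there is a unique positive integer $n$ such that the program variable $n$ has this value with $\mu_0$-probability $1$. For this $n$ and all positive integer inputs $a_1,\dots,a_n$ (with $h,H$ computed from them), the final sub-distribution $\mu=[\![C_{\mathrm{FLDR}}]\!](\mu_0)$ satisfies $$\forall\,1\le i\le n:\qquad \sum_{\sigma\,:\,H[\sigma(d),\sigma(c)]=i}\mu(\sigma)\;\le\;\frac{a_i}{m}.$$ -/

import Mathlib

open scoped ENNReal

namespace ProbProg

/-! Probabilistic programs over a set `V` of integer-valued program variables. -/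

/-- A program state assigns an integer to every program variable. -/
abbrev State (V : Type) : Type := V → ℤ

/-- Non-negative mass functions on `S`. Sub-distributions are those of total mass at most `1`.
Values lie in `[0, ∞]`, so that all sums below are honest sums. -/
abbrev Mass (S : Type) : Type := S → ℝ≥0∞

/-- The Dirac distribution at `a`. -/
noncomputable def dirac {S : Type} (a : S) : Mass S := Set.indicator {a} 1

/-- The filtered mass function `[B] · μ`. -/
noncomputable def filt {S : Type} (B : S → Prop) (μ : Mass S) : Mass S :=
  Set.indicator {s | B s} μ

/-- The probability `∑_{s ⊨ B} μ(s)` that `B` holds in `μ`. -/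
noncomputable def pr {S : Type} (μ : Mass S) (B : S → Prop) : ℝ≥0∞ :=
  ∑' s : {s : S // B s}, μ s

/-- Syntax of probabilistic programs. Expressions and guards are arbitrary functions of the state.
`choice p C₁ C₂` runs `C₁` with probability `p` and `C₂` with probability `1 - p`. -/
inductive Prog (V : Type) : Type
  | skip : Prog V
  | assign (x : V) (e : State V → ℤ) : Prog V
  | choice (p : unitInterval) (C₁ C₂ : Prog V) : Prog V
  | seq (C₁ C₂ : Prog V) : Prog V
  | ite (B : State V → Prop) (C₁ C₂ : Prog V) : Prog V
  | loop (B : State V → Prop) (C : Prog V) : Prog V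

/-- The functional `Φ(f) = λ η. [¬B] · η + f (T ([B] · η))` of a loop with guard `B` whose body
has semantics `T`. It is monotone in `f` for the pointwise order. -/
noncomputable def loopFunctional {S : Type} (B : S → Prop) (T : Mass S → Mass S) :
    (Mass S → Mass S) →o (Mass S → Mass S) where
  toFun f := fun η => filt (fun s => ¬ B s) η + f (T (filt B η))
  monotone' := fun _ _ hfg η => add_le_add le_rfl (hfg (T (filt B η)))

/-- Denotational semantics: `den C μ` is the output (sub-)distribution of `C` on the input
(sub-)distribution `μ`. The meaning of a loop is the least fixed point of its functional. The
least fixed point is taken among all transformers of `[0, ∞]`-valued mass functions, as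
`loopFunctional B T f` need not have mass at most `1` for an arbitrary `f`; by fixed point
iteration from `0` it agrees with the one on sub-distributions. -/
noncomputable def den {V : Type} [DecidableEq V] : Prog V → Mass (State V) → Mass (State V)
  | .skip, μ => μ
  | .assign x e, μ => fun σ =>
      ∑' σ' : {σ' : State V // Function.update σ' x (e σ') = σ}, μ σ'
  | .choice p C₁ C₂, μ =>
      den C₁ (fun σ => ENNReal.ofReal (p : ℝ) * μ σ) +
        den C₂ (fun σ => ENNReal.ofReal (1 - (p : ℝ)) * μ σ)
  | .seq C₁ C₂, μ => den C₂ (den C₁ μ)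
  | .ite B C₁ C₂, μ => den C₁ (filt B μ) + den C₂ (filt (fun σ => ¬ B σ) μ)
  | .loop B C, μ => OrderHom.lfp (loopFunctional B (den C)) μ

end ProbProg

namespace FLDR

open ProbProg

/-! The Fast Loaded Dice Roller: preprocessing. The inputs are `a 1, …, a n`; other values of
the function `a` are never read. -/

/-- `m = a₁ + ⋯ + aₙ`. -/
def total (n : ℕ) (a : ℕ → ℕ) : ℕ := ∑ i ∈ Finset.Icc 1 n, a i

/-- `k = ⌈log₂ m⌉`. -/
def depth (n : ℕ) (a : ℕ → ℕ) : ℕ := Nat.clog 2 (total n a)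

/-- The weights `a₁, …, aₙ` together with the weight `aₙ₊₁ = 2ᵏ - m` of the rejection side. -/
def weights (n : ℕ) (a : ℕ → ℕ) : ℕ → ℕ :=
  Function.update a (n + 1) (2 ^ depth n a - total n a)

/-- `bound h c = 2ᶜ - ∑_{j=0}^{c} h[j] · 2^{c-j}`, where the sum is empty for `c < 0`. -/
def bound (h : ℤ → ℤ) (c : ℤ) : ℚ :=
  (2 : ℚ) ^ c - ∑ j ∈ Finset.range (c + 1).toNat, (h j : ℚ) * (2 : ℚ) ^ (c - j)

/-- The memory of the preprocessing: the array `h`, the matrix `H` (with `H d c` the entry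
`H[d,c]`), and the position `d` written to next. -/
structure Memory : Type where
  h : ℤ → ℤ
  H : ℤ → ℤ → ℤ
  d : ℤ

/-- Body of the inner loop: `w` is the bit of weight `2^{k-j}` of the `i`-th weight; then
`h[j] := h[j] + w`, and if `w` is set, `H[d,j] := i; d := d - 1`. -/
def innerStep (n : ℕ) (a : ℕ → ℕ) (j : ℕ) (s : Memory) (i : ℕ) : Memory :=
  if (weights n a i).testBit (depth n a - j) then
    { h := Function.update s.h j (s.h j + 1)
      H := fun d c => if d = s.d ∧ c = (j : ℤ) then (i : ℤ) else s.H d c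
      d := s.d - 1 }
  else s

/-- Body of the outer loop: start at the rightmost node `d = 2 · bound h (j-1) - 1` of row `j`
(an integer) and run the inner loop for `i = 1, …, n + 1`. -/
def outerStep (n : ℕ) (a : ℕ → ℕ) (s : Memory) (j : ℕ) : Memory :=
  (List.range' 1 (n + 1)).foldl (innerStep n a j)
    { s with d := ⌊2 * bound s.h ((j : ℤ) - 1) - 1⌋ }

/-- The preprocessing: run the outer loop for `j = 0, …, k`, with `h` and `H` initially zero. -/
def preprocess (n : ℕ) (a : ℕ → ℕ) : Memory :=
  (List.range (depth n a + 1)).foldl (outerStep n a) ⟨fun _ => 0, fun _ _ => 0, 0⟩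

/-! The Fast Loaded Dice Roller: the program. -/

/-- The program variables `c`, `d`, `n`. -/
inductive Var : Type
  | c
  | d
  | n
  deriving DecidableEq

/-- The fair coin probability. -/
noncomputable def half : unitInterval := ⟨1 / 2, by norm_num, by norm_num⟩

/-- The FLDR program for the array `h` and the matrix `H`:
`while (d < bound h c) { c := c + 1; {d := 2d} [1/2] {d := 2d + 1};
if (H[d,c] = n + 1) {c := 0; d := 0} }`. -/
noncomputable def prog (h : ℤ → ℤ) (H : ℤ → ℤ → ℤ) : Prog Var :=
  .loop (fun σ => (σ .d : ℚ) < bound h (σ .c))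
    (.seq (.assign .c (fun σ => σ .c + 1))
      (.seq
        (.choice half (.assign .d (fun σ => 2 * σ .d)) (.assign .d (fun σ => 2 * σ .d + 1)))
        (.ite (fun σ => H (σ .d) (σ .c) = σ .n + 1)
          (.seq (.assign .c (fun _ => 0)) (.assign .d (fun _ => 0)))
          .skip)))

/-- The state `d ↦ 0, c ↦ 0, n ↦ N`. -/
def initState (N : ℕ) : State Var
  | .c => 0
  | .d => 0
  | .n => N

/-- The initial distributions: the Dirac distributions at `d ↦ 0, c ↦ 0, n ↦ N` for `N > 0`. -/
def initialDistributions : Set (Mass (State Var)) :=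
  {μ | ∃ N : ℕ, 0 < N ∧ μ = dirac (initState N)}

/-- The output distribution of the FLDR with inputs `a 1, …, a N` on `μ₀`. -/
noncomputable def final (N : ℕ) (a : ℕ → ℕ) (μ₀ : Mass (State Var)) : Mass (State Var) :=
  den (prog (preprocess N a).h (preprocess N a).H) μ₀

end FLDR

/-! View the run as a walk down a binary tree, each level listing its internal nodes to the left of
its leaves. For every weight with its bit of weight `2^{k-j}` set, level `j` has one leaf with that
label, so label `v` is reached in one descent with probability `weights v / 2^k`. Put `p = a i / m`
and value a leaf by `1` if labelled `i`, by `p` if labelled `n+1`, by `0` otherwise. The root then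
has value `(a i + p * (2^k - m)) / 2^k = p` (`treeValue_root`), so a reset, which trades a rejection
leaf for the root, preserves the value.

Hence the value of the current node is a super-invariant of the loop (`bodyValue_le`). It dominates
the indicator of label `i` on exit (`indicator_le_invariant`), and the loop rule `expect_lfp_le`
bounds the probability by its initial value `p`. That the preprocessing builds this tree is
`foldl_outerStep`. -/

namespace ProbProg

/-! ### Expected values and their transformation by programs -/

variable {S V : Type}

/-- The expected value of `f` in the mass function `μ`. -/
noncomputable def expect (μ : Mass S) (f : S → ℝ≥0∞) : ℝ≥0∞ := ∑' s, f s * μ s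

lemma expect_add (μ ν : Mass S) (f : S → ℝ≥0∞) :
    expect (μ + ν) f = expect μ f + expect ν f := by
  simp only [expect, Pi.add_apply, mul_add, ENNReal.tsum_add]

lemma expect_const_mul (p : ℝ≥0∞) (μ : Mass S) (f : S → ℝ≥0∞) :
    expect (fun s => p * μ s) f = expect μ (fun s => p * f s) := by
  simp only [expect]
  exact tsum_congr fun s => by ring

lemma expect_add_right (μ : Mass S) (f g : S → ℝ≥0∞) :
    expect μ (fun s => f s + g s) = expect μ f + expect μ g := by
  simp only [expect, add_mul, ENNReal.tsum_add]

lemma expect_mono (μ : Mass S) {f g : S → ℝ≥0∞} (h : ∀ s, f s ≤ g s) :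
    expect μ f ≤ expect μ g :=
  ENNReal.tsum_le_tsum fun s => mul_le_mul_left (h s) _

lemma expect_filt (B : S → Prop) [DecidablePred B] (μ : Mass S) (f : S → ℝ≥0∞) :
    expect (filt B μ) f = expect μ (fun s => if B s then f s else 0) := by
  simp only [expect]
  refine tsum_congr fun s => ?_
  by_cases h : B s <;> simp [filt, h]

lemma expect_dirac (a : S) (f : S → ℝ≥0∞) : expect (dirac a) f = f a := by
  rw [expect, tsum_eq_single a]
  · simp [dirac]
  · intro b hb
    simp [dirac, hb]

lemma pr_eq_expect (μ : Mass S) (B : S → Prop) [DecidablePred B] :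
    pr μ B = expect μ (fun s => if B s then 1 else 0) := by
  have h : pr μ B = ∑' s : ({s | B s} : Set S), μ s := rfl
  rw [h, tsum_subtype, expect]
  refine tsum_congr fun s => ?_
  by_cases h : B s <;> simp [h]

section
variable [DecidableEq V]

lemma den_seq (C₁ C₂ : Prog V) (μ : Mass (State V)) : den (.seq C₁ C₂) μ = den C₂ (den C₁ μ) := by
  rw [den]

/-- The sums defining the output run over the fibres of the update map, and these fibres partition
the state space. -/
lemma expect_den_assign (x : V) (e : State V → ℤ) (μ : Mass (State V)) (f : State V → ℝ≥0∞) :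
    expect (den (.assign x e) μ) f = expect μ (fun σ => f (Function.update σ x (e σ))) := by
  have h : ∀ σ, f σ * den (.assign x e) μ σ =
      ∑' σ' : {σ' : State V // Function.update σ' x (e σ') = σ},
        f (Function.update σ'.1 x (e σ'.1)) * μ σ' := by
    intro σ
    rw [den, ← ENNReal.tsum_mul_left]
    exact tsum_congr fun σ' => by rw [σ'.2]
  simp only [expect, h]
  rw [← ENNReal.tsum_sigma]
  exact (Equiv.sigmaFiberEquiv fun σ : State V => Function.update σ x (e σ)).tsum_eq
    (fun σ => f (Function.update σ x (e σ)) * μ σ)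

lemma expect_den_choice (p : unitInterval) (C₁ C₂ : Prog V) (μ : Mass (State V))
    (f w₁ w₂ : State V → ℝ≥0∞) (h₁ : ∀ η, expect (den C₁ η) f = expect η w₁)
    (h₂ : ∀ η, expect (den C₂ η) f = expect η w₂) :
    expect (den (.choice p C₁ C₂) μ) f =
      expect μ (fun σ => ENNReal.ofReal p * w₁ σ + ENNReal.ofReal (1 - p) * w₂ σ) := by
  rw [den, expect_add, h₁, h₂, expect_const_mul, expect_const_mul, expect_add_right]

lemma expect_den_ite (B : State V → Prop) [DecidablePred B] (C₁ C₂ : Prog V) (μ : Mass (State V))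
    (f w₁ w₂ : State V → ℝ≥0∞) (h₁ : ∀ η, expect (den C₁ η) f = expect η w₁)
    (h₂ : ∀ η, expect (den C₂ η) f = expect η w₂) :
    expect (den (.ite B C₁ C₂) μ) f = expect μ (fun σ => if B σ then w₁ σ else w₂ σ) := by
  rw [den, expect_add, h₁, h₂, expect_filt, expect_filt, ← expect_add_right]
  congr 1
  ext σ
  by_cases h : B σ <;> simp [h]

end

/-! ### The loop rule -/

/-- The supremum of the iterates is a fixed point because addition commutes with suprema. No
continuity of `T` is needed: it only acts on the fixed argument `filt B η`. -/
lemma lfp_loopFunctional_le_iSup (B : S → Prop) (T : Mass S → Mass S) :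
    OrderHom.lfp (loopFunctional B T) ≤ ⨆ t : ℕ, (loopFunctional B T)^[t] ⊥ := by
  apply OrderHom.lfp_le
  intro η σ
  have h : (loopFunctional B T (⨆ t : ℕ, (loopFunctional B T)^[t] ⊥)) η σ =
      ⨆ t : ℕ, ((loopFunctional B T)^[t + 1] ⊥) η σ := by
    simp only [Function.iterate_succ_apply']
    change filt (fun s => ¬ B s) η σ +
      (⨆ t : ℕ, (loopFunctional B T)^[t] ⊥ : Mass S → Mass S) (T (filt B η)) σ = ⨆ t : ℕ,
        (filt (fun s => ¬ B s) η σ + ((loopFunctional B T)^[t] ⊥) (T (filt B η)) σ)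
    simp only [iSup_apply, ENNReal.add_iSup]
  rw [h]
  simp only [iSup_apply]
  exact iSup_le fun t => le_iSup (fun t => ((loopFunctional B T)^[t] ⊥) η σ) (t + 1)

/-- The loop rule: a super-invariant `I` bounds the expected value of `f` after a loop. -/
theorem expect_lfp_le (B : S → Prop) (T : Mass S → Mass S) (f I w : S → ℝ≥0∞)
    (hw : ∀ η, expect (T η) I = expect η w) (hstep : ∀ s, B s → w s ≤ I s)
    (hexit : ∀ s, ¬ B s → f s ≤ I s) (μ : Mass S) :
    expect (OrderHom.lfp (loopFunctional B T) μ) f ≤ expect μ I := by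
  classical
  have hiter : ∀ (t : ℕ) (η : Mass S),
      expect (((loopFunctional B T)^[t] ⊥) η) f ≤ expect η I := by
    intro t
    induction t with
    | zero => intro η; simp [expect]
    | succ t ih =>
      intro η
      rw [Function.iterate_succ_apply']
      change expect (filt (fun s => ¬ B s) η + ((loopFunctional B T)^[t] ⊥) (T (filt B η))) f ≤ _
      rw [expect_add]
      refine (add_le_add_right (ih _) _).trans ?_
      rw [hw, expect_filt, expect_filt, ← expect_add_right]
      refine expect_mono η fun s => ?_
      by_cases h : B s
      · simpa [h] using hstep s h
      · simpa [h] using hexit s h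
  have hmono : Monotone fun t : ℕ => (loopFunctional B T)^[t] ⊥ :=
    Monotone.monotone_iterate_of_le_map (loopFunctional B T).monotone bot_le
  calc expect (OrderHom.lfp (loopFunctional B T) μ) f
      ≤ ∑' s, ⨆ t : ℕ, f s * ((loopFunctional B T)^[t] ⊥) μ s := by
        refine ENNReal.tsum_le_tsum fun s => ?_
        rw [← ENNReal.mul_iSup]
        have := lfp_loopFunctional_le_iSup B T μ s
        simp only [iSup_apply] at this
        exact mul_le_mul_right this _
    _ ≤ expect μ I := by
        rw [ENNReal.tsum_eq_iSup_sum]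
        refine iSup_le fun u => ?_
        -- Over a finite set the sum commutes with the supremum of the increasing iterates, and each
        -- iterate is bounded by `hiter`.
        rw [ENNReal.finsetSum_iSup_of_monotone (f := fun s t => f s * ((loopFunctional B T)^[t] ⊥) μ s)
          fun s t t' h => mul_le_mul_right (hmono h μ s) _]
        exact iSup_le fun t => (ENNReal.sum_le_tsum u).trans (hiter t μ)

end ProbProg

/-! ### Values of labelled binary trees -/

namespace FLDR

open ProbProg

/-- The expected value of the leaf labels `g` below node `d` of level `c` in a binary tree whose
level `c` has its `q c` internal nodes to the left of its leaves, explored to depth `l`. -/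
noncomputable def treeValue (q : ℕ → ℕ) (g : ℕ → ℕ → ℝ≥0∞) : ℕ → ℕ → ℕ → ℝ≥0∞
  | 0, c, d => g c d
  | l + 1, c, d =>
      if q c ≤ d then g c d
      else (treeValue q g l (c + 1) (2 * d) + treeValue q g l (c + 1) (2 * d + 1)) / 2

lemma treeValue_leaf (q : ℕ → ℕ) (g : ℕ → ℕ → ℝ≥0∞) (l c d : ℕ) (h : q c ≤ d) :
    treeValue q g l c d = g c d := by
  cases l <;> simp [treeValue, h]

lemma sum_range_two_mul {M : Type*} [AddCommMonoid M] (f : ℕ → M) (n : ℕ) :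
    ∑ d ∈ Finset.range (2 * n), f d = ∑ d ∈ Finset.range n, (f (2 * d) + f (2 * d + 1)) := by
  induction n with
  | zero => simp
  | succ n ih =>
    rw [show 2 * (n + 1) = 2 * n + 1 + 1 by ring, Finset.sum_range_succ, Finset.sum_range_succ,
      ih, Finset.sum_range_succ, add_assoc]

/-- The values on a level add up to the discounted sum of the labels of all leaves below. -/
lemma sum_treeValue (q r : ℕ → ℕ) (g : ℕ → ℕ → ℝ≥0∞) (hr : ∀ c, r (c + 1) = 2 * q c) (l : ℕ) :
    ∀ c, (∀ j, j ≤ l → q (c + j) ≤ r (c + j)) → q (c + l) = 0 →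
      ∑ d ∈ Finset.range (r c), treeValue q g l c d =
        ∑ j ∈ Finset.range (l + 1),
          (∑ d ∈ Finset.Ico (q (c + j)) (r (c + j)), g (c + j) d) / 2 ^ j := by
  induction l with
  | zero =>
    intro c _ h0
    simp only [add_zero] at h0
    simp [treeValue, h0]
  | succ l ih =>
    intro c hle h0
    have hshift : ∀ j, c + (j + 1) = c + 1 + j := fun j => by ring
    rw [Finset.sum_range_succ']
    have hle0 : q c ≤ r c := hle 0 (Nat.zero_le _)
    simp only [add_zero, pow_zero, div_one]
    rw [← Finset.sum_range_add_sum_Ico _ hle0, add_comm]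
    have hleaf : ∑ d ∈ Finset.Ico (q c) (r c), treeValue q g (l + 1) c d =
        ∑ d ∈ Finset.Ico (q c) (r c), g c d :=
      Finset.sum_congr rfl fun d hd => treeValue_leaf q g _ c d (Finset.mem_Ico.1 hd).1
    -- Since `r (c + 1) = 2 * q c`, the next level consists exactly of the children of the internal
    -- nodes of this one.
    have hinner : ∑ d ∈ Finset.range (q c), treeValue q g (l + 1) c d =
        (∑ d ∈ Finset.range (r (c + 1)), treeValue q g l (c + 1) d) / 2 := by
      rw [hr, sum_range_two_mul, div_eq_mul_inv, Finset.sum_mul]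
      refine Finset.sum_congr rfl fun d hd => ?_
      have : ¬ q c ≤ d := by simpa using hd
      simp [treeValue, this, div_eq_mul_inv]
    rw [hleaf, hinner, ih (c + 1) (fun j hj => by rw [← hshift]; exact hle _ (by omega))
      (by rw [← hshift]; exact h0), add_comm, div_eq_mul_inv, Finset.sum_mul]
    congr 1
    refine Finset.sum_congr rfl fun j _ => ?_
    rw [hshift j, pow_succ, div_eq_mul_inv, div_eq_mul_inv, mul_assoc,
      ENNReal.mul_inv (Or.inr (by simp)) (Or.inl (by simp))]

/-! ### Binary digits and node counts -/

lemma sum_testBit_mul_two_pow (x K : ℕ) :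
    ∑ t ∈ Finset.range K, (x.testBit t).toNat * 2 ^ t = x % 2 ^ K := by
  induction K with
  | zero => simp [Nat.mod_one]
  | succ K ih => rw [Finset.sum_range_succ, ih, Nat.mod_pow_succ, Nat.toNat_testBit, mul_comm]

/-- The bit of weight `2^{k-j}` of the `i`-th weight. -/
def digit (n : ℕ) (a : ℕ → ℕ) (i j : ℕ) : ℕ :=
  ((weights n a i).testBit (depth n a - j)).toNat

/-- The number of the first `t` weights whose bit of weight `2^{k-j}` is set. -/
def leafCount (n : ℕ) (a : ℕ → ℕ) (t j : ℕ) : ℕ := ∑ i ∈ Finset.Icc 1 t, digit n a i j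

/-- The number of internal nodes on level `c`. -/
def innerCount (n : ℕ) (a : ℕ → ℕ) (c : ℕ) : ℕ :=
  2 ^ c - ∑ j ∈ Finset.range (c + 1), leafCount n a (n + 1) j * 2 ^ (c - j)

/-- The number of nodes on level `c`. -/
def width (n : ℕ) (a : ℕ → ℕ) : ℕ → ℕ
  | 0 => 1
  | c + 1 => 2 * innerCount n a c

lemma total_le (n : ℕ) (a : ℕ → ℕ) : total n a ≤ 2 ^ depth n a :=
  Nat.le_pow_clog (by norm_num) _

lemma weights_le (n : ℕ) (a : ℕ → ℕ) (i : ℕ) (hi : i ∈ Finset.Icc 1 (n + 1)) :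
    weights n a i ≤ 2 ^ depth n a := by
  rcases eq_or_ne i (n + 1) with rfl | h
  · simp [weights]
  · rw [weights, Function.update_of_ne h]
    refine le_trans ?_ (total_le n a)
    rw [Finset.mem_Icc] at hi
    exact Finset.single_le_sum (f := a) (fun _ _ => Nat.zero_le _)
      (Finset.mem_Icc.2 ⟨hi.1, by omega⟩)

lemma sum_digit (n : ℕ) (a : ℕ → ℕ) (i : ℕ) (hi : i ∈ Finset.Icc 1 (n + 1)) :
    ∑ j ∈ Finset.range (depth n a + 1), digit n a i j * 2 ^ (depth n a - j) = weights n a i := by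
  -- `depth + 1` bits are needed, as a weight may equal `2^k`.
  have h := sum_testBit_mul_two_pow (weights n a i) (depth n a + 1)
  rw [Nat.mod_eq_of_lt, ← Finset.sum_range_reflect] at h
  · simpa [digit] using h
  · have := weights_le n a i hi
    rw [pow_succ]
    have : 0 < 2 ^ depth n a := by positivity
    omega

lemma sum_weights (n : ℕ) (a : ℕ → ℕ) :
    ∑ i ∈ Finset.Icc 1 (n + 1), weights n a i = 2 ^ depth n a := by
  rw [Finset.sum_Icc_succ_top (by omega)]
  have h : ∑ i ∈ Finset.Icc 1 n, weights n a i = total n a :=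
    Finset.sum_congr rfl fun i hi => by
      rw [Finset.mem_Icc] at hi
      rw [weights, Function.update_of_ne (by omega)]
  rw [h, weights, Function.update_self]
  have := total_le n a
  omega

/-- Kraft's equality: exchanging the sums over levels and labels leaves the sum of all weights,
which is `2^k`. -/
lemma sum_leafCount (n : ℕ) (a : ℕ → ℕ) :
    ∑ j ∈ Finset.range (depth n a + 1), leafCount n a (n + 1) j * 2 ^ (depth n a - j) =
      2 ^ depth n a := by
  simp only [leafCount, Finset.sum_mul]
  rw [Finset.sum_comm, ← sum_weights n a]
  exact Finset.sum_congr rfl fun i hi => sum_digit n a i hi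

/-- Scaled by `2^(k-c)`, the left side is a partial sum of Kraft's equality. Thus the natural
subtraction in `innerCount` never truncates up to level `k`. -/
lemma sum_leafCount_le (n : ℕ) (a : ℕ → ℕ) (c : ℕ) (hc : c ≤ depth n a) :
    ∑ j ∈ Finset.range (c + 1), leafCount n a (n + 1) j * 2 ^ (c - j) ≤ 2 ^ c := by
  have h2 : 0 < 2 ^ (depth n a - c) := by positivity
  refine Nat.le_of_mul_le_mul_right ?_ h2
  rw [← pow_add, Nat.add_sub_cancel' hc, ← sum_leafCount n a, Finset.sum_mul]
  calc ∑ j ∈ Finset.range (c + 1), leafCount n a (n + 1) j * 2 ^ (c - j) * 2 ^ (depth n a - c)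
      = ∑ j ∈ Finset.range (c + 1), leafCount n a (n + 1) j * 2 ^ (depth n a - j) :=
        Finset.sum_congr rfl fun j hj => by
          rw [Finset.mem_range] at hj
          rw [mul_assoc, ← pow_add]
          congr 2
          omega
    _ ≤ _ := Finset.sum_le_sum_of_subset (Finset.range_mono (by omega))

lemma innerCount_depth (n : ℕ) (a : ℕ → ℕ) : innerCount n a (depth n a) = 0 := by
  rw [innerCount, sum_leafCount, Nat.sub_self]

lemma innerCount_add_leafCount (n : ℕ) (a : ℕ → ℕ) (c : ℕ) (hc : c ≤ depth n a) :
    innerCount n a c + leafCount n a (n + 1) c = width n a c := by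
  have h := sum_leafCount_le n a c hc
  cases c with
  | zero =>
    simp only [zero_add, Finset.range_one, Finset.sum_singleton, Nat.sub_zero, pow_zero,
      mul_one] at h
    simp [innerCount, width]
    omega
  | succ c =>
    have h' := sum_leafCount_le n a c (by omega)
    have e : ∑ j ∈ Finset.range (c + 1), leafCount n a (n + 1) j * 2 ^ (c + 1 - j) =
        2 * ∑ j ∈ Finset.range (c + 1), leafCount n a (n + 1) j * 2 ^ (c - j) := by
      rw [Finset.mul_sum]
      refine Finset.sum_congr rfl fun j hj => ?_
      rw [Finset.mem_range] at hj
      rw [Nat.sub_add_comm (by omega), pow_succ]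
      ring
    rw [Finset.sum_range_succ, e, Nat.sub_self, pow_zero, mul_one, pow_succ] at h
    rw [width, innerCount, innerCount, Finset.sum_range_succ, e, Nat.sub_self, pow_zero, mul_one,
      pow_succ]
    omega

lemma bound_eq_innerCount (n : ℕ) (a : ℕ → ℕ) (h : ℤ → ℤ) (c : ℕ) (hc : c ≤ depth n a)
    (hh : ∀ j : ℕ, j ≤ c → h j = leafCount n a (n + 1) j) :
    bound h c = innerCount n a c := by
  rw [bound, innerCount, Nat.cast_sub (sum_leafCount_le n a c hc)]
  have : ((c : ℤ) + 1).toNat = c + 1 := by omega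
  rw [this]
  push_cast
  rw [zpow_natCast]
  congr 1
  refine Finset.sum_congr rfl fun j hj => ?_
  rw [Finset.mem_range] at hj
  rw [hh j (by omega), ← Nat.cast_sub (by omega), zpow_natCast]
  simp

lemma floor_two_mul_bound (n : ℕ) (a : ℕ → ℕ) (h : ℤ → ℤ) (j : ℕ) (hj : j ≤ depth n a)
    (hh : ∀ x : ℕ, x < j → h x = leafCount n a (n + 1) x) :
    ⌊2 * bound h ((j : ℤ) - 1) - 1⌋ = (width n a j : ℤ) - 1 := by
  cases j with
  -- Here `bound h (-1) = 2⁻¹`, so the formula gives position `0`, the root.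
  | zero => simp [bound, width]
  | succ c =>
    have : ((c + 1 : ℕ) : ℤ) - 1 = c := by push_cast; ring
    rw [this, bound_eq_innerCount n a h c (by omega) fun x hx => hh x (by omega), width]
    rw [Int.floor_eq_iff]
    push_cast
    constructor <;> linarith

/-! ### Correctness of the preprocessing -/

/-- The memory after `t` rounds of the inner loop filling row `j`, started from `s`. -/
structure InnerSpec (n : ℕ) (a : ℕ → ℕ) (j : ℕ) (s : Memory) (t : ℕ) (u : Memory) : Prop where
  pos : u.d = s.d - leafCount n a t j
  count : ∀ x, u.h x = if x = j then s.h j + leafCount n a t j else s.h x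
  other : ∀ d c, c ≠ (j : ℤ) → u.H d c = s.H d c
  left : ∀ d ≤ u.d, u.H d j = s.H d j
  sum : ∀ F : ℤ → ℝ≥0∞, ∑ x ∈ Finset.range (leafCount n a t j), F (u.H (s.d - x) j) =
    ∑ i ∈ Finset.Icc 1 t, digit n a i j * F i

/-- Each set bit writes one cell and moves left, so cells already written are not overwritten.
Testing against an arbitrary `F` records how often each label occurs without naming its position. -/
lemma foldl_innerStep (n : ℕ) (a : ℕ → ℕ) (j : ℕ) (s : Memory) (t : ℕ) :
    InnerSpec n a j s t ((List.range' 1 t).foldl (innerStep n a j) s) := by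
  induction t with
  | zero =>
    refine ⟨?_, ?_, ?_, ?_, ?_⟩
    · simp [leafCount]
    · intro x
      split_ifs with h <;> simp [leafCount, h]
    · simp
    · simp
    · simp [leafCount]
  | succ t ih =>
    rw [List.range'_1_concat, List.foldl_append, List.foldl_cons, List.foldl_nil]
    generalize (List.range' 1 t).foldl (innerStep n a j) s = u at ih
    rw [add_comm 1 t]
    have hcount : leafCount n a (t + 1) j = leafCount n a t j + digit n a (t + 1) j := by
      rw [leafCount, Finset.sum_Icc_succ_top (by omega), leafCount]
    by_cases hb : (weights n a (t + 1)).testBit (depth n a - j) = true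
    · have hd : digit n a (t + 1) j = 1 := by simp [digit, hb]
      rw [innerStep, if_pos hb]
      rw [hd] at hcount
      refine ⟨?_, ?_, ?_, ?_, ?_⟩
      · simp only [hcount, ih.pos]
        push_cast
        ring
      · intro x
        simp only [Function.update_apply, ih.count, hcount]
        split_ifs
        · push_cast
          ring
        · rfl
      · intro d c hc
        simp only [hc, and_false, if_false]
        exact ih.other d c hc
      · intro d hd'
        simp only at hd' ⊢
        rw [if_neg (by omega)]
        exact ih.left d (by omega)
      · intro F
        rw [hcount, Finset.sum_range_succ, Finset.sum_Icc_succ_top (by omega), hd, ← ih.sum F]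
        congr 1
        · refine Finset.sum_congr rfl fun x hx => ?_
          rw [Finset.mem_range] at hx
          simp only
          have := ih.pos
          rw [if_neg (by omega)]
        · simp [ih.pos]
    · have hd : digit n a (t + 1) j = 0 := by simp [digit, hb]
      rw [innerStep, if_neg hb]
      rw [hd, add_zero] at hcount
      refine ⟨by rw [hcount]; exact ih.pos, by rw [hcount]; exact ih.count, ih.other, ih.left, ?_⟩
      intro F
      rw [hcount, Finset.sum_Icc_succ_top (by omega), hd, ih.sum F]
      simp

/-- The memory after the first `J` rows have been filled. -/
structure OuterSpec (n : ℕ) (a : ℕ → ℕ) (J : ℕ) (u : Memory) : Prop where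
  count : ∀ x : ℕ, u.h x = if x < J then (leafCount n a (n + 1) x : ℤ) else 0
  later : ∀ (d : ℤ) (c : ℕ), J ≤ c → u.H d c = 0
  left : ∀ (c : ℕ), c < J → ∀ d : ℤ, d < innerCount n a c → u.H d c = 0
  sum : ∀ (c : ℕ), c < J → ∀ F : ℤ → ℝ≥0∞,
    ∑ d ∈ Finset.Ico (innerCount n a c) (width n a c), F (u.H d c) =
      ∑ i ∈ Finset.Icc 1 (n + 1), digit n a i c * F i

lemma foldl_outerStep (n : ℕ) (a : ℕ → ℕ) (J : ℕ) (hJ : J ≤ depth n a + 1) :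
    OuterSpec n a J ((List.range J).foldl (outerStep n a) ⟨fun _ => 0, fun _ _ => 0, 0⟩) := by
  induction J with
  | zero => exact ⟨by simp, by simp, by simp, by simp⟩
  | succ J ih =>
    specialize ih (by omega)
    rw [List.range_succ, List.foldl_append, List.foldl_cons, List.foldl_nil]
    generalize (List.range J).foldl (outerStep n a) ⟨fun _ => 0, fun _ _ => 0, 0⟩ = s at ih
    rw [outerStep, floor_two_mul_bound n a s.h J (by omega) fun x hx => by
      rw [ih.count, if_pos hx]]
    have key := foldl_innerStep n a J { s with d := (width n a J : ℤ) - 1 } (n + 1)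
    generalize (List.range' 1 (n + 1)).foldl (innerStep n a J)
      { s with d := (width n a J : ℤ) - 1 } = u at key
    have hw := innerCount_add_leafCount n a J (by omega)
    obtain ⟨kpos, kcount, kother, kleft, ksum⟩ := key
    simp only at kpos kcount kother kleft ksum
    refine ⟨?_, ?_, ?_, ?_⟩
    · intro x
      rw [kcount]
      rcases lt_trichotomy x J with h | h | h
      · rw [if_neg (by omega), ih.count, if_pos h, if_pos (by omega)]
      · subst h
        rw [if_pos rfl, ih.count, if_neg (by omega), if_pos (by omega), zero_add]
      · rw [if_neg (by omega), ih.count, if_neg (by omega), if_neg (by omega)]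
    · intro d c hc
      rw [kother d c (by omega)]
      exact ih.later d c (by omega)
    · intro c hc d hd
      rcases eq_or_ne c J with rfl | h
      · rw [kleft d (by omega)]
        exact ih.later d c le_rfl
      · rw [kother d c (by omega)]
        exact ih.left c (by omega) d hd
    · intro c hc F
      rcases eq_or_ne c J with rfl | h
      -- The inner loop fills the row from right to left, hence the reflection.
      · rw [← ksum F, Finset.sum_Ico_eq_sum_range, ← hw, Nat.add_sub_cancel_left,
          ← Finset.sum_range_reflect]
        refine Finset.sum_congr rfl fun x hx => ?_
        rw [Finset.mem_range] at hx
        congr 2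
        omega
      · rw [← ih.sum c (by omega) F]
        exact Finset.sum_congr rfl fun d _ => by rw [kother _ c (by omega)]

lemma preprocess_spec (n : ℕ) (a : ℕ → ℕ) :
    OuterSpec n a (depth n a + 1) (preprocess n a) :=
  foldl_outerStep n a _ le_rfl

lemma bound_preprocess (n : ℕ) (a : ℕ → ℕ) (c : ℕ) (hc : c ≤ depth n a) :
    bound (preprocess n a).h c = innerCount n a c :=
  bound_eq_innerCount n a _ c hc fun j hj => by
    rw [(preprocess_spec n a).count, if_pos (by omega)]

/-! ### The super-invariant of the program -/

/-- The value of label `x`: one for `i`, and `p` for rejection. -/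
noncomputable def labelValue (n i : ℕ) (p : ℝ≥0∞) (x : ℤ) : ℝ≥0∞ :=
  if x = i then 1 else if x = n + 1 then p else 0

/-- The value of the root of the tree is the value of rejection. -/
lemma treeValue_root (n : ℕ) (a : ℕ → ℕ) (i : ℕ) (hi : 1 ≤ i) (hin : i ≤ n) (hpos : 0 < a i) :
    treeValue (innerCount n a)
      (fun c d => labelValue n i (a i / total n a) ((preprocess n a).H d c)) (depth n a) 0 0 =
      a i / total n a := by
  set p : ℝ≥0∞ := a i / total n a
  have htot : 0 < total n a := hpos.trans_le <|
    Finset.single_le_sum (f := a) (fun _ _ => Nat.zero_le _) (Finset.mem_Icc.2 ⟨hi, hin⟩)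
  have hai : (a i : ℝ≥0∞) = p * total n a :=
    (ENNReal.div_mul_cancel (by exact_mod_cast htot.ne') (by simp)).symm
  have h := sum_treeValue (innerCount n a) (width n a)
    (fun c d => labelValue n i p ((preprocess n a).H d c)) (fun _ => rfl) (depth n a) 0
    (fun j hj => by
      rw [zero_add, ← innerCount_add_leafCount n a j hj]; omega)
    (by rw [zero_add, innerCount_depth])
  have hroot : width n a 0 = 1 := rfl
  simp only [hroot, Finset.range_one, Finset.sum_singleton, zero_add] at h
  rw [h]
  have hlevel : ∀ j ∈ Finset.range (depth n a + 1),
      (∑ d ∈ Finset.Ico (innerCount n a j) (width n a j),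
        labelValue n i p ((preprocess n a).H d j)) / 2 ^ j =
      (((digit n a i j * 2 ^ (depth n a - j) : ℕ) : ℝ≥0∞) +
        p * ((digit n a (n + 1) j * 2 ^ (depth n a - j) : ℕ) : ℝ≥0∞)) / 2 ^ depth n a := by
    intro j hj
    rw [(preprocess_spec n a).sum j (Finset.mem_range.1 hj)]
    have hlabel : ∑ v ∈ Finset.Icc 1 (n + 1), (digit n a v j : ℝ≥0∞) * labelValue n i p (v : ℤ) =
        digit n a i j + p * digit n a (n + 1) j := by
      rw [Finset.sum_Icc_succ_top (by omega), Finset.sum_eq_single i]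
      · have h' : ¬ ((n : ℤ) + 1 = i) := by omega
        simp [labelValue, h', mul_comm]
      · intro v hv hvi
        rw [Finset.mem_Icc] at hv
        rw [labelValue, if_neg (by omega), if_neg (by omega), mul_zero]
      · intro hni
        exact absurd (Finset.mem_Icc.2 ⟨hi, hin⟩) hni
    rw [hlabel]
    rw [Finset.mem_range] at hj
    have hpow : (2 : ℝ≥0∞) ^ depth n a = 2 ^ j * 2 ^ (depth n a - j) := by
      rw [← pow_add]; congr 1; omega
    rw [hpow]
    push_cast
    rw [← mul_assoc, ← add_mul, ENNReal.mul_div_mul_right _ _ (by simp) (by simp)]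
  rw [Finset.sum_congr rfl hlevel]
  simp only [div_eq_mul_inv]
  rw [← Finset.sum_mul, Finset.sum_add_distrib, ← Finset.mul_sum, ← Nat.cast_sum, ← Nat.cast_sum,
    sum_digit n a i (Finset.mem_Icc.2 ⟨hi, by omega⟩),
    sum_digit n a (n + 1) (Finset.mem_Icc.2 ⟨by omega, le_rfl⟩)]
  have hwi : weights n a i = a i := by rw [weights, Function.update_of_ne (by omega)]
  have hwn : weights n a (n + 1) = 2 ^ depth n a - total n a := by
    rw [weights, Function.update_self]
  -- With `a i = p * m`, the numerator is `p * m + p * (2^k - m) = p * 2^k`.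
  rw [hwi, hwn, hai, ← mul_add, ← Nat.cast_add, Nat.add_sub_cancel' (total_le n a), mul_assoc]
  push_cast
  rw [ENNReal.mul_inv_cancel (by simp) (by simp), mul_one]

/-- A super-invariant of the program: the probability of reaching label `i`. -/
noncomputable def invariant (n : ℕ) (a : ℕ → ℕ) (i : ℕ) (σ : State Var) : ℝ≥0∞ :=
  if 0 ≤ σ .c ∧ σ .c ≤ depth n a ∧ 0 ≤ σ .d ∧ σ .n = n then
    treeValue (innerCount n a)
      (fun c d => labelValue n i (a i / total n a) ((preprocess n a).H d c))
      (depth n a - (σ .c).toNat) (σ .c).toNat (σ .d).toNat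
  else ⊤

lemma invariant_of_eq (n : ℕ) (a : ℕ → ℕ) (i : ℕ) (σ : State Var) (c d : ℕ) (hc : σ .c = c)
    (hd : σ .d = d) (hn : σ .n = n) (hk : c ≤ depth n a) :
    invariant n a i σ = treeValue (innerCount n a)
      (fun c d => labelValue n i (a i / total n a) ((preprocess n a).H d c))
      (depth n a - c) c d := by
  rw [invariant, if_pos (by omega), hc, hd]
  simp

/-- The expected value of `f` after one round of the loop body. -/
noncomputable def bodyValue (H : ℤ → ℤ → ℤ) (f : State Var → ℝ≥0∞) (σ : State Var) : ℝ≥0∞ :=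
  let after (τ : State Var) : ℝ≥0∞ :=
    if H (τ .d) (τ .c) = τ .n + 1 then
      f (Function.update (Function.update τ .c 0) .d 0) else f τ
  let τ := Function.update σ .c (σ .c + 1)
  ENNReal.ofReal half * after (Function.update τ .d (2 * τ .d)) +
    ENNReal.ofReal (1 - half) * after (Function.update τ .d (2 * τ .d + 1))

lemma expect_body (H : ℤ → ℤ → ℤ) (f : State Var → ℝ≥0∞) (η : Mass (State Var)) :
    expect (den (.seq (.assign .c (fun σ => σ .c + 1))
      (.seq
        (.choice half (.assign .d (fun σ => 2 * σ .d)) (.assign .d (fun σ => 2 * σ .d + 1)))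
        (.ite (fun σ => H (σ .d) (σ .c) = σ .n + 1)
          (.seq (.assign .c (fun _ => 0)) (.assign .d (fun _ => 0)))
          .skip))) η) f = expect η (bodyValue H f) := by
  rw [den_seq, den_seq, expect_den_ite _ _ _ _ f
    (fun τ => f (Function.update (Function.update τ .c 0) .d 0)) f
    (fun η => by rw [den_seq, expect_den_assign, expect_den_assign]) (fun η => by rw [den]),
    expect_den_choice _ _ _ _ _ _ _ (fun η => expect_den_assign _ _ η _)
      (fun η => expect_den_assign _ _ η _), expect_den_assign]
  rfl

lemma ofReal_half : ENNReal.ofReal (half : ℝ) = 2⁻¹ := by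
  rw [show ((half : unitInterval) : ℝ) = 2⁻¹ by simp [half], ENNReal.ofReal_inv_of_pos (by norm_num)]
  simp

lemma ofReal_one_sub_half : ENNReal.ofReal (1 - (half : ℝ)) = 2⁻¹ := by
  rw [← ofReal_half]
  congr 1
  norm_num [half]

lemma bodyValue_le (n : ℕ) (a : ℕ → ℕ) (i : ℕ) (hi : 1 ≤ i) (hin : i ≤ n) (hpos : 0 < a i)
    (σ : State Var) (hσ : (σ .d : ℚ) < bound (preprocess n a).h (σ .c)) :
    bodyValue (preprocess n a).H (invariant n a i) σ ≤ invariant n a i σ := by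
  -- Outside this range the invariant is `⊤` and there is nothing to prove.
  by_cases hI : 0 ≤ σ .c ∧ σ .c ≤ depth n a ∧ 0 ≤ σ .d ∧ σ .n = n
  swap
  · rw [invariant, if_neg hI]
    exact le_top
  obtain ⟨hc0, hck, hd0, hn⟩ := hI
  obtain ⟨c, hc⟩ := Int.eq_ofNat_of_zero_le hc0
  obtain ⟨d, hd⟩ := Int.eq_ofNat_of_zero_le hd0
  rw [hc] at hck
  have hck' : c ≤ depth n a := by exact_mod_cast hck
  rw [hc, hd, bound_preprocess n a c hck'] at hσ
  have hdq : d < innerCount n a c := by exact_mod_cast hσ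
  -- Level `k` has no internal nodes, so the guard fails there.
  have hlt : c < depth n a := by
    refine lt_of_le_of_ne hck' fun h => ?_
    rw [h, innerCount_depth] at hdq
    omega
  have hafter : ∀ (τ : State Var) (e : ℕ), τ .c = (c + 1 : ℕ) → τ .d = e → τ .n = n →
      (if (preprocess n a).H (τ .d) (τ .c) = τ .n + 1 then
        invariant n a i (Function.update (Function.update τ .c 0) .d 0)
        else invariant n a i τ) ≤
      treeValue (innerCount n a)
        (fun c d => labelValue n i (a i / total n a) ((preprocess n a).H d c))
        (depth n a - (c + 1)) (c + 1) e := by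
    intro τ e hτc hτd hτn
    split_ifs with hH
    · rw [invariant_of_eq n a i _ 0 0 (by simp) (by simp) (by simp [hτn]) (Nat.zero_le _),
        Nat.sub_zero, treeValue_root n a i hi hin hpos]
      rw [hτc, hτd, hτn] at hH
      -- Internal nodes keep the initial entry `0`, which is not `n + 1`; so a reset happens only at
      -- a leaf, of value `p`.
      have hleaf : innerCount n a (c + 1) ≤ e := by
        by_contra! hlt'
        rw [(preprocess_spec n a).left (c + 1) (by omega) e (by exact_mod_cast hlt')] at hH
        omega
      rw [treeValue_leaf _ _ _ _ _ hleaf, hH, labelValue, if_neg (by omega), if_pos rfl]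
    · rw [invariant_of_eq n a i τ (c + 1) e hτc hτd hτn hlt]
  rw [invariant_of_eq n a i σ c d hc hd hn hck', bodyValue, ofReal_half, ofReal_one_sub_half,
    show depth n a - c = depth n a - (c + 1) + 1 by omega, treeValue, if_neg (by omega),
    div_eq_mul_inv, mul_comm _ (2⁻¹ : ℝ≥0∞), mul_add]
  refine add_le_add (mul_le_mul_right ?_ _) (mul_le_mul_right ?_ _)
  · refine hafter (Function.update (Function.update σ .c (σ .c + 1)) .d (2 * σ .d)) (2 * d) ?_ ?_ ?_
    all_goals simp [hc, hd, hn]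
  · refine hafter (Function.update (Function.update σ .c (σ .c + 1)) .d (2 * σ .d + 1))
      (2 * d + 1) ?_ ?_ ?_
    all_goals simp [hc, hd, hn]

lemma indicator_le_invariant (n : ℕ) (a : ℕ → ℕ) (i : ℕ) (σ : State Var)
    (hσ : ¬ (σ .d : ℚ) < bound (preprocess n a).h (σ .c)) :
    (if (preprocess n a).H (σ .d) (σ .c) = (i : ℤ) then 1 else 0) ≤ invariant n a i σ := by
  split_ifs with hH
  swap
  · exact zero_le
  by_cases hI : 0 ≤ σ .c ∧ σ .c ≤ depth n a ∧ 0 ≤ σ .d ∧ σ .n = n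
  swap
  · rw [invariant, if_neg hI]
    exact le_top
  obtain ⟨hc0, hck, hd0, hn⟩ := hI
  obtain ⟨c, hc⟩ := Int.eq_ofNat_of_zero_le hc0
  obtain ⟨d, hd⟩ := Int.eq_ofNat_of_zero_le hd0
  rw [hc] at hck
  have hck' : c ≤ depth n a := by exact_mod_cast hck
  rw [hc, hd, bound_preprocess n a c hck'] at hσ
  have hdq : innerCount n a c ≤ d := by exact_mod_cast not_lt.1 hσ
  rw [hc, hd] at hH
  rw [invariant_of_eq n a i σ c d hc hd hn hck', treeValue_leaf _ _ _ _ _ hdq, hH, labelValue,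
    if_pos rfl]

lemma pr_final_le (n : ℕ) (a : ℕ → ℕ) (i : ℕ) (hi : 1 ≤ i) (hin : i ≤ n) (hpos : 0 < a i) :
    pr (final n a (dirac (initState n)))
      (fun σ => (preprocess n a).H (σ .d) (σ .c) = (i : ℤ)) ≤ a i / total n a := by
  rw [pr_eq_expect, final, prog, den]
  refine (expect_lfp_le _ _ _ (invariant n a i) _ (expect_body _ _)
    (bodyValue_le n a i hi hin hpos) (indicator_le_invariant n a i) _).trans ?_
  rw [expect_dirac, invariant_of_eq n a i _ 0 0 rfl rfl rfl (Nat.zero_le _), Nat.sub_zero,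
    treeValue_root n a i hi hin hpos]

lemma pr_initState (M N : ℕ) :
    pr (dirac (initState M)) (fun σ => σ .n = (N : ℤ)) = 1 ↔ N = M := by
  rw [pr_eq_expect, expect_dirac]
  simp [initState, eq_comm]

end FLDR

theorem mainTheorem9 (μ₀ : ProbProg.Mass (ProbProg.State FLDR.Var))
    (hμ₀ : μ₀ ∈ FLDR.initialDistributions) :
    (∃! N : ℕ, 0 < N ∧ ProbProg.pr μ₀ (fun σ => σ FLDR.Var.n = (N : ℤ)) = 1) ∧
    ∀ N : ℕ, 0 < N → ProbProg.pr μ₀ (fun σ => σ FLDR.Var.n = (N : ℤ)) = 1 →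
      ∀ a : ℕ → ℕ, (∀ i : ℕ, 1 ≤ i → i ≤ N → 0 < a i) →
        ∀ i : ℕ, 1 ≤ i → i ≤ N →
          ProbProg.pr (FLDR.final N a μ₀)
              (fun σ => (FLDR.preprocess N a).H (σ FLDR.Var.d) (σ FLDR.Var.c) = (i : ℤ)) ≤
            (a i : ENNReal) / ((∑ l ∈ Finset.Icc 1 N, a l : ℕ) : ENNReal) := by
  obtain ⟨M, hM, rfl⟩ := hμ₀
  refine ⟨⟨M, ⟨hM, (FLDR.pr_initState M M).2 rfl⟩, fun N hN => (FLDR.pr_initState M N).1 hN.2⟩, ?_⟩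
  intro N _ hN a ha i hi hiN
  obtain rfl := (FLDR.pr_initState M N).1 hN
  exact FLDR.pr_final_le N a i hi hiN (ha i hi hiN)
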